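/- All graphs are finite, simple and undirected. Let $G=(V,E)$ be a graph with distance function $d_G$, where $d_G(u,v)=\infty$ if $u$ and $v$ lie in different components. For $k\ge 1$, a set $D\subseteq V$ is a distance $k$-dominating set if every $v\in V\setminus D$ satisfies $d_G(v,x)\le k$ for some $x\in D$; a set $W\subseteq V$ is a resolving set if for any two distinct $u,v\in V\setminus W$ there is $w\in W$ with $d_G(u,w)\ne d_G(v,w)$. The distance $k$-resolving domination number $\gamma^r_k(G)$ is the minimum cardinality of a set $S\subseteq V$ that is both a resolving set and a distance $k$-dominating set of $G$. Let $P_n$ and $K_n$ be the path and the complete graph on $n$ vertices, $K_{s,t}$ the complete bipartite graph with parts of sizes $s$ and $t$, $\overline{H}$ the complement of $H$, $H_1\cup H_2$ the disjoint union, and $H_1+H_2$ the join, obtained from $H_1\cup H_2$ by joining every vertex of $H_1$ to every vertex of $H_2$. Theorem. Let $G$ be a graph of order $n\ge 2$. (a) For every $k\ge 1$, $\gamma^r_k(G)=1$ if and only if $G$ is isomorphic to $P_i$ for some $i$ with $2\le i\le k+1$. (b) Suppose that $G$ is connected and $n\ge 4$. Then $\gamma^r_2(G)=n-2$ if and only if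 $G$ is isomorphic to one of the graphs $P_4$, $K_{s,t}$ ($s,t\ge 1$), $K_s+\overline{K}_t$ ($s\ge 1$, $t\ge 2$), $K_s+(K_1\cup K_t)$ ($s,t\ge 1$). For every $k\ge 3$, $\gamma^r_k(G)=n-2$ if and only if $G$ is isomorphic to one of the graphs $K_{s,t}$ ($s,t\ge 1$), $K_s+\overline{K}_t$ ($s\ge 1$, $t\ge 2$), $K_s+(K_1\cup K_t)$ ($s,t\ge 1$). (c) If $G$ is connected, then for every $k\ge 2$, $\gamma^r_k(G)=n-1$ if and only if $G\cong K_n$. -/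

import Mathlib

namespace ResolvingDomination

/-- The metric representation `c(v|W)` of a vertex `v` with respect to the vertices of `W`;
the distance between vertices of different components is `⊤`. -/
noncomputable def metricRep {V : Type*} (G : SimpleGraph V) (W : Finset V) (v : V) : W → ℕ∞ :=
  fun w => G.edist v w

/-- `W` is a resolving set: distinct vertices outside `W` have distinct metric representations. -/
def IsResolvingSet {V : Type*} (G : SimpleGraph V) (W : Finset V) : Prop :=
  ∀ u v : V, u ∉ W → v ∉ W → u ≠ v → metricRep G W u ≠ metricRep G W v

/-- `D` is a distance `k`-dominating set: every vertex outside `D` is at distance at most `k`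
from some vertex of `D`. -/
def IsDistDominatingSet {V : Type*} (G : SimpleGraph V) (k : ℕ) (D : Finset V) : Prop :=
  ∀ v : V, v ∉ D → ∃ x ∈ D, G.edist v x ≤ (k : ℕ∞)

/-- A distance `k`-resolving dominating set. -/
def IsDistResolvingDominatingSet {V : Type*} (G : SimpleGraph V) (k : ℕ) (S : Finset V) : Prop :=
  IsResolvingSet G S ∧ IsDistDominatingSet G k S

/-- The distance `k`-resolving domination number `γ^r_k(G)`: the minimum cardinality of a
distance `k`-resolving dominating set. -/
noncomputable def distResolvingDominationNumber {V : Type*} (G : SimpleGraph V) (k : ℕ) : ℕ :=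
  sInf {m : ℕ | ∃ S : Finset V, IsDistResolvingDominatingSet G k S ∧ S.card = m}

/-- On a finite graph the minimum defining `γ^r_k(G)` is attained. -/
theorem isLeast_distResolvingDominationNumber {V : Type*} [Fintype V] (G : SimpleGraph V)
    (k : ℕ) :
    IsLeast {m : ℕ | ∃ S : Finset V, IsDistResolvingDominatingSet G k S ∧ S.card = m}
      (distResolvingDominationNumber G k) := by
  refine ⟨Nat.sInf_mem ⟨_, Finset.univ, ⟨?_, ?_⟩, rfl⟩, fun m hm => Nat.sInf_le hm⟩
  · intro u v hu
    exact absurd (Finset.mem_univ u) hu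
  · intro v hv
    exact absurd (Finset.mem_univ v) hv

/-- The join `G + H`: the disjoint union of `G` and `H` together with all edges between a vertex
of `G` and a vertex of `H`. -/
def joinGraph {V W : Type*} (G : SimpleGraph V) (H : SimpleGraph W) : SimpleGraph (V ⊕ W) :=
  SimpleGraph.sum G H ⊔ completeBipartiteGraph V W

/-- The complete graph `K_n`. -/
def K (n : ℕ) : SimpleGraph (Fin n) := SimpleGraph.completeGraph (Fin n)

/-- `G` is isomorphic to one of the graphs `K_{s,t}` with `s, t ≥ 1`, `K_s + (complement of K_t)`
with `s ≥ 1`, `t ≥ 2`, or `K_s + (K_1 ∪ K_t)` with `s, t ≥ 1`. -/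
def InFamily {V : Type*} (G : SimpleGraph V) : Prop :=
  (∃ s t : ℕ, 1 ≤ s ∧ 1 ≤ t ∧ Nonempty (G ≃g completeBipartiteGraph (Fin s) (Fin t))) ∨
  (∃ s t : ℕ, 1 ≤ s ∧ 2 ≤ t ∧ Nonempty (G ≃g joinGraph (K s) (K t)ᶜ)) ∨
  (∃ s t : ℕ, 1 ≤ s ∧ 1 ≤ t ∧ Nonempty (G ≃g joinGraph (K s) (SimpleGraph.sum (K 1) (K t))))

end ResolvingDomination

/-! A one-vertex set `{w}` works exactly when the distances from `w` are pairwise distinct and at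
most `k`, which makes `G` a path with end `w` and at most `k + 1` vertices. This is (a).

For (c), no two omitted vertices of a complete graph can be separated, while a connected noncomplete
graph has a geodesic `a, b, c`, and `a` alone separates and dominates the omitted pair `b, c` once
`k ≥ 2`.

For (b), suppose first that nonadjacent vertices always have a common neighbour. Distances are then
at most 2, so domination is automatic and separation is read off from adjacency; three vertices can
be omitted unless every triple contains two vertices with equal neighbourhoods outside it.
`HasTwinsInTriples.exists_decomposition` shows that, in a noncomplete graph, this forces a join of
some neighbourhood `A = N(w)` with its complement `B`, each side being of a very restricted type;
these joins are the three families. Otherwise there is a geodesic `x₀, x₁, x₂, x₃`. Its end `x₀`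
separates the other three, so omitting them can fail only through domination of `x₃`, hence only for
`k = 2`. Failure from both ends leaves no room for further vertices, and `G` is the path on four
vertices. -/

namespace ResolvingDomination

open SimpleGraph

/-! ### Geodesics and distances in connected graphs. -/

section Distance

variable {V : Type*} {G : SimpleGraph V}

/-- A vertex at distance `m + 1` from `u` has a neighbour at distance `m` from `u`. -/
theorem exists_adj_dist_eq (hc : G.Connected) {u v : V} {m : ℕ} (h : G.dist u v = m + 1) :
    ∃ x, G.Adj x v ∧ G.dist u x = m := by
  obtain ⟨p, hp⟩ := hc.exists_walk_length_eq_dist v u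
  cases p with
  | nil => simp at h
  | cons hadj q =>
    rename_i x
    refine ⟨x, hadj.symm, ?_⟩
    have h1 : G.dist x u ≤ q.length := dist_le q
    have h2 : G.dist u v ≤ G.dist u x + G.dist x v := hc.dist_triangle
    rw [dist_eq_one_iff_adj.2 hadj.symm] at h2
    rw [Walk.length_cons, dist_comm, h] at hp
    rw [dist_comm] at h1
    omega

/-- All the distances between `0` and `G.dist u v` are attained. -/
theorem exists_dist_eq_of_le (hc : G.Connected) {u v : V} {j : ℕ} (h : j ≤ G.dist u v) :
    ∃ x, G.dist u x = j := by
  obtain ⟨d, hd⟩ := Nat.exists_eq_add_of_le h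
  clear h
  induction d generalizing v with
  | zero => exact ⟨v, by omega⟩
  | succ d ih =>
    obtain ⟨x, -, hx⟩ := exists_adj_dist_eq hc (m := j + d) (by omega)
    exact ih hx

/-- A finite connected graph in which the distances from some vertex are pairwise distinct is
a path. -/
theorem nonempty_iso_pathGraph_of_dist_injective [Fintype V] (hc : G.Connected) (w : V)
    (hw : Function.Injective (G.dist w)) : Nonempty (G ≃g pathGraph (Fintype.card V)) := by
  have hlt : ∀ v, G.dist w v < Fintype.card V := fun v => by
    obtain ⟨p, hp, hl⟩ := hc.exists_path_of_dist w v
    exact hl ▸ hp.length_lt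
  have hbij : Function.Bijective (fun v => (⟨G.dist w v, hlt v⟩ : Fin (Fintype.card V))) := by
    rw [Fintype.bijective_iff_injective_and_card]
    exact ⟨fun a b h => hw (Fin.mk.inj h), by simp⟩
  -- Some neighbour of `b` lies one level closer to `w`, and by injectivity `a` is the only vertex
  -- on that level.
  have step : ∀ a b, G.dist w a + 1 = G.dist w b → G.Adj a b := fun a b h => by
    obtain ⟨x, hx, hd⟩ := exists_adj_dist_eq hc h.symm
    rwa [hw hd] at hx
  refine ⟨⟨Equiv.ofBijective _ hbij, ?_⟩⟩
  intro a b
  simp only [Equiv.ofBijective_apply, pathGraph_adj]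
  constructor
  · rintro (h | h)
    · exact step a b h
    · exact (step b a h).symm
  · intro h
    have h1 := hw.ne h.ne
    have h2 := hc.dist_triangle (u := w) (v := a) (w := b)
    have h3 := hc.dist_triangle (u := w) (v := b) (w := a)
    rw [dist_eq_one_iff_adj.2 h] at h2
    rw [dist_eq_one_iff_adj.2 h.symm] at h3
    omega

/-- In a path the distance from the first vertex is the position. -/
theorem edist_eq_of_iso_pathGraph {n : ℕ} (e : G ≃g pathGraph n) {w : V}
    (hw : (e w).val = 0) (v : V) : G.edist w v = ((e v).val : ℕ∞) := by
  have hadj : ∀ a b, G.Adj a b ↔ (e a).val + 1 = (e b).val ∨ (e b).val + 1 = (e a).val := by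
    intro a b
    rw [← e.map_adj_iff, pathGraph_adj]
  apply le_antisymm
  · obtain ⟨j, hj⟩ : ∃ j, (e v).val = j := ⟨_, rfl⟩
    rw [hj]
    induction j generalizing v with
    | zero =>
      have : w = v := e.injective (Fin.ext (by omega))
      simp [this]
    | succ j ih =>
      have hlt : j < n := by have := (e v).isLt; omega
      have hx : (e (e.symm ⟨j, hlt⟩)).val = j := by simp
      have h1 := ih _ hx
      have h2 : G.edist (e.symm ⟨j, hlt⟩) v = 1 := by
        rw [edist_eq_one_iff_adj, hadj]
        omega
      calc G.edist w v ≤ _ := SimpleGraph.edist_triangle (v := e.symm ⟨j, hlt⟩)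
        _ ≤ (j : ℕ∞) + 1 := by rw [h2]; gcongr
        _ = ((j + 1 : ℕ) : ℕ∞) := by push_cast; rfl
  -- Each edge changes the position by one, which bounds the length of every walk from below.
  · have key : ∀ {a b : V} (p : G.Walk a b), (e b).val ≤ (e a).val + p.length := by
      intro a b p
      induction p with
      | nil => simp
      | cons h p ih =>
        have := (hadj _ _).1 h
        rw [Walk.length_cons]
        omega
    rw [edist_eq_sInf]
    apply le_sInf
    rintro _ ⟨p, rfl⟩
    have := key p
    exact Nat.cast_le.2 (by omega : (e v).val ≤ p.length)

theorem isResolvingSet_iff {W : Finset V} : IsResolvingSet G W ↔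
    ∀ u v : V, u ∉ W → v ∉ W → u ≠ v → ∃ w ∈ W, G.edist u w ≠ G.edist v w := by
  simp only [IsResolvingSet, metricRep, Ne, funext_iff, not_forall, Subtype.exists, exists_prop]

/-- A connected graph which is not complete has a geodesic of length two. -/
theorem exists_not_adj_adj_adj (hc : G.Connected) (hG : G ≠ ⊤) :
    ∃ a b c, a ≠ c ∧ ¬ G.Adj a c ∧ G.Adj a b ∧ G.Adj b c := by
  obtain ⟨x, y, hxy, hna⟩ : ∃ x y, x ≠ y ∧ ¬ G.Adj x y := by
    by_contra! h
    exact hG (top_le_iff.1 fun a b hab => h a b (by simpa using hab))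
  have h2 := hc.one_lt_dist_of_ne_of_not_adj hxy hna
  obtain ⟨c, hcd⟩ := exists_dist_eq_of_le hc h2
  obtain ⟨b, hb, hbd⟩ := exists_adj_dist_eq hc hcd
  refine ⟨x, b, c, ?_, ?_, dist_eq_one_iff_adj.1 hbd, hb⟩
  · rintro rfl
    simp at hcd
  · intro h
    rw [dist_eq_one_iff_adj.2 h] at hcd
    omega

end Distance

/-! ### Values 1 and `n - 1`. -/

section General

variable {V : Type*} [Fintype V] {G : SimpleGraph V} {k : ℕ}

theorem distResolvingDominationNumber_le {S : Finset V}
    (hS : IsDistResolvingDominatingSet G k S) : distResolvingDominationNumber G k ≤ S.card :=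
  (isLeast_distResolvingDominationNumber G k).2 ⟨S, hS, rfl⟩

theorem exists_card_eq_distResolvingDominationNumber (G : SimpleGraph V) (k : ℕ) :
    ∃ S : Finset V, IsDistResolvingDominatingSet G k S ∧
      S.card = distResolvingDominationNumber G k :=
  (isLeast_distResolvingDominationNumber G k).1

theorem distResolvingDominationNumber_pos [Nonempty V] :
    0 < distResolvingDominationNumber G k := by
  obtain ⟨S, hS, hcard⟩ := exists_card_eq_distResolvingDominationNumber G k
  rw [← hcard, Finset.card_pos]
  by_contra hne
  rw [Finset.not_nonempty_iff_eq_empty] at hne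
  subst hne
  obtain ⟨x, hx, -⟩ := hS.2 (Classical.arbitrary V) (by simp)
  simp at hx

theorem distResolvingDominationNumber_eq_one_iff (hn : 2 ≤ Fintype.card V) (k : ℕ) :
    distResolvingDominationNumber G k = 1 ↔
      ∃ i : ℕ, 2 ≤ i ∧ i ≤ k + 1 ∧ Nonempty (G ≃g pathGraph i) := by
  classical
  have hne : Nonempty V := Fintype.card_pos_iff.1 (by omega)
  constructor
  · intro h
    obtain ⟨S, hS, hcard⟩ := exists_card_eq_distResolvingDominationNumber G k
    rw [h, Finset.card_eq_one] at hcard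
    obtain ⟨w, rfl⟩ := hcard
    have hle : ∀ v, G.edist w v ≤ (k : ℕ∞) := by
      intro v
      by_cases hv : v = w
      · simp [hv]
      · obtain ⟨x, hx, hxk⟩ := hS.2 v (by simpa using hv)
        rw [Finset.mem_singleton] at hx
        rwa [edist_comm, ← hx]
    -- Connectedness is not assumed; it follows because every vertex is at finite distance from `w`.
    have hr : ∀ v, G.Reachable w v := fun v =>
      reachable_of_edist_ne_top (ne_top_of_le_ne_top (ENat.natCast_ne_top k) (hle v))
    have hc : G.Connected := ⟨fun a b => (hr a).symm.trans (hr b)⟩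
    have hdk : ∀ v, G.dist w v ≤ k := by
      intro v
      have := hle v
      rw [← (hr v).coe_dist_eq_edist] at this
      exact_mod_cast this
    have hinj : Function.Injective (G.dist w) := by
      intro a b hab
      by_contra hne
      -- The resolving condition concerns only vertices other than `w`; for `w` itself, distance 0
      -- decides.
      by_cases ha : a = w
      · subst ha
        rw [dist_self] at hab
        exact hne (hc.dist_eq_zero_iff.1 hab.symm)
      by_cases hb : b = w
      · subst hb
        rw [dist_self] at hab
        exact hne (hc.dist_eq_zero_iff.1 hab).symm
      obtain ⟨x, hx, hd⟩ := isResolvingSet_iff.1 hS.1 a b (by simpa using ha)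
        (by simpa using hb) hne
      rw [Finset.mem_singleton] at hx
      subst hx
      apply hd
      rw [edist_comm, edist_comm (u := b), ← (hr a).coe_dist_eq_edist,
        ← (hr b).coe_dist_eq_edist, hab]
    refine ⟨Fintype.card V, hn, ?_, nonempty_iso_pathGraph_of_dist_injective hc w hinj⟩
    have := Fintype.card_le_of_injective
      (fun v => (⟨G.dist w v, Nat.lt_succ_of_le (hdk v)⟩ : Fin (k + 1)))
      (fun a b h => hinj (Fin.mk.inj h))
    simpa using this
  · rintro ⟨i, hi, hik, ⟨e⟩⟩
    set w := e.symm ⟨0, by omega⟩ with hw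
    have hd : ∀ v, G.edist v w = ((e v).val : ℕ∞) := fun v => by
      rw [edist_comm]
      exact edist_eq_of_iso_pathGraph e (by simp [hw]) v
    refine le_antisymm ?_ distResolvingDominationNumber_pos
    refine (distResolvingDominationNumber_le (S := {w}) ⟨?_, ?_⟩).trans (by simp)
    · rw [isResolvingSet_iff]
      refine fun u v _ _ huv => ⟨w, by simp, ?_⟩
      rw [hd, hd, Ne, Nat.cast_inj]
      exact fun h => huv (e.injective (Fin.ext h))
    · refine fun v _ => ⟨w, by simp, ?_⟩
      rw [hd, Nat.cast_le]
      have := (e v).isLt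
      omega

theorem nonempty_iso_K_iff : Nonempty (G ≃g K (Fintype.card V)) ↔ G = ⊤ := by
  constructor
  · rintro ⟨e⟩
    ext a b
    rw [← e.map_adj_iff]
    simp only [K, completeGraph_eq_top, top_adj]
    exact not_congr e.injective.eq_iff
  · rintro rfl
    exact ⟨Iso.completeGraph (Fintype.equivFin V)⟩

theorem distResolvingDominationNumber_top (hn : 2 ≤ Fintype.card V) (hk : 1 ≤ k) :
    distResolvingDominationNumber (⊤ : SimpleGraph V) k = Fintype.card V - 1 := by
  classical
  have hV : Nontrivial V := Fintype.one_lt_card_iff_nontrivial.1 hn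
  apply le_antisymm
  · obtain ⟨a, b, hab⟩ := exists_pair_ne V
    have hcard : (Finset.univ.erase a).card = Fintype.card V - 1 := by
      rw [Finset.card_erase_of_mem (Finset.mem_univ a), Finset.card_univ]
    rw [← hcard]
    apply distResolvingDominationNumber_le
    refine ⟨fun u v hu hv huv => absurd ?_ huv, fun v hv => ⟨b, by simp [hab.symm], ?_⟩⟩
    · simp only [Finset.mem_erase, Finset.mem_univ, and_true, not_not] at hu hv
      rw [hu, hv]
    · simp only [Finset.mem_erase, Finset.mem_univ, and_true, not_not] at hv
      subst hv
      rw [edist_top_of_ne hab]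
      exact_mod_cast hk
  · obtain ⟨S, hS, hcard⟩ := exists_card_eq_distResolvingDominationNumber (⊤ : SimpleGraph V) k
    rw [← hcard]
    have h1 : Sᶜ.card ≤ 1 := by
      rw [Finset.card_le_one]
      intro u hu v hv
      rw [Finset.mem_compl] at hu hv
      by_contra hne
      obtain ⟨w, hw, hd⟩ := isResolvingSet_iff.1 hS.1 u v hu hv hne
      apply hd
      rw [edist_top_of_ne (by rintro rfl; exact hu hw),
        edist_top_of_ne (by rintro rfl; exact hv hw)]
    rw [Finset.card_compl] at h1
    omega

/-- On a geodesic `a, b, c` the vertices `b` and `c` are at distances 1 and 2 from `a`, so both can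
be omitted. -/
theorem distResolvingDominationNumber_le_card_sub_two (hc : G.Connected) (hG : G ≠ ⊤)
    (hk : 2 ≤ k) : distResolvingDominationNumber G k ≤ Fintype.card V - 2 := by
  classical
  obtain ⟨a, b, c, hac, hna, hab, hbc⟩ := exists_not_adj_adj_adj hc hG
  have hcard : ({b, c} : Finset V)ᶜ.card = Fintype.card V - 2 := by
    rw [Finset.card_compl, Finset.card_pair hbc.ne]
  have hb : G.edist b a = 1 := edist_eq_one_iff_adj.2 hab.symm
  have hcd : G.edist c a = 2 :=
    edist_eq_two_iff.2 ⟨hac.symm, fun h => hna h.symm, b, hbc.symm, hab⟩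
  have ha : a ∈ ({b, c} : Finset V)ᶜ := by simp [hab.ne, hac]
  have hk' : (2 : ℕ∞) ≤ k := by exact_mod_cast hk
  rw [← hcard]
  refine distResolvingDominationNumber_le ⟨?_, ?_⟩
  · rw [isResolvingSet_iff]
    intro u v hu hv huv
    refine ⟨a, ha, ?_⟩
    simp only [Finset.mem_compl, Finset.mem_insert, Finset.mem_singleton, not_not] at hu hv
    rcases hu with rfl | rfl <;> rcases hv with rfl | rfl <;>
      first | exact absurd rfl huv | (rw [hb, hcd]; decide)
  · intro v hv
    refine ⟨a, ha, ?_⟩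
    simp only [Finset.mem_compl, Finset.mem_insert, Finset.mem_singleton, not_not] at hv
    rcases hv with rfl | rfl
    · rw [hb]
      exact le_trans (by decide) hk'
    · rwa [hcd]

theorem distResolvingDominationNumber_eq_card_sub_one_iff (hn : 2 ≤ Fintype.card V)
    (hc : G.Connected) (hk : 2 ≤ k) :
    distResolvingDominationNumber G k = Fintype.card V - 1 ↔
      Nonempty (G ≃g K (Fintype.card V)) := by
  rw [nonempty_iso_K_iff]
  constructor
  · intro h
    by_contra hG
    have := distResolvingDominationNumber_le_card_sub_two hc hG hk
    omega
  · rintro rfl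
    exact distResolvingDominationNumber_top hn (by omega)

end General

/-! ### Structure of noncomplete graphs with twins in every triple. -/

section Structure

variable {V W : Type*} {G : SimpleGraph V} {H : SimpleGraph W}

/-- Distinct nonadjacent vertices have a common neighbour. -/
def HasCommonNeighbors (G : SimpleGraph V) : Prop :=
  ∀ u v, u ≠ v → ¬ G.Adj u v → ∃ x, G.Adj u x ∧ G.Adj x v

/-- Among any three vertices there are two with the same neighbours outside the triple. -/
def HasTwinsInTriples (G : SimpleGraph V) : Prop :=
  ∀ a b c, a ≠ b → a ≠ c → b ≠ c →
    (∀ w, w ≠ a → w ≠ b → w ≠ c → (G.Adj w a ↔ G.Adj w b)) ∨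
    (∀ w, w ≠ a → w ≠ b → w ≠ c → (G.Adj w a ↔ G.Adj w c)) ∨
    (∀ w, w ≠ a → w ≠ b → w ≠ c → (G.Adj w b ↔ G.Adj w c))

theorem HasCommonNeighbors.of_iso (h : HasCommonNeighbors H) (e : G ≃g H) :
    HasCommonNeighbors G := by
  intro u v huv hna
  obtain ⟨x, hx⟩ := h (e u) (e v) (e.injective.ne huv) (by rwa [e.map_adj_iff])
  refine ⟨e.symm x, ?_⟩
  rw [← e.map_adj_iff, ← e.map_adj_iff (v := e.symm x), e.apply_symm_apply]
  exact hx

theorem HasTwinsInTriples.of_iso (h : HasTwinsInTriples H) (e : G ≃g H) :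
    HasTwinsInTriples G := by
  intro a b c hab hac hbc
  have key : ∀ u v, (∀ w, w ≠ e a → w ≠ e b → w ≠ e c → (H.Adj w (e u) ↔ H.Adj w (e v))) →
      ∀ w, w ≠ a → w ≠ b → w ≠ c → (G.Adj w u ↔ G.Adj w v) := by
    intro u v huv w ha hb hc
    rw [← e.map_adj_iff, ← e.map_adj_iff (v := w)]
    exact huv (e w) (e.injective.ne ha) (e.injective.ne hb) (e.injective.ne hc)
  exact (h (e a) (e b) (e c) (e.injective.ne hab) (e.injective.ne hac) (e.injective.ne hbc)).imp
    (key a b) (Or.imp (key a c) (key b c))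

theorem ne_top_of_iso (h : H ≠ ⊤) (e : G ≃g H) : G ≠ ⊤ := by
  rintro rfl
  apply h
  ext a b
  rw [← e.symm.map_adj_iff]
  simp [e.symm.injective.eq_iff]

/-- Two vertices outside a triple cannot separate its three members. -/
theorem HasTwinsInTriples.not_separated (h : HasTwinsInTriples G) {a b c x y : V}
    (hbc : b ≠ c) (hxa : x ≠ a) (hxb : x ≠ b) (hxc : x ≠ c) (hya : y ≠ a) (hyb : y ≠ b)
    (hyc : y ≠ c) (h1 : ¬ (G.Adj x a ↔ G.Adj x b)) (h2 : G.Adj x b ↔ G.Adj x c) :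
    G.Adj y b ↔ G.Adj y c := by
  have hab : a ≠ b := by rintro rfl; exact h1 Iff.rfl
  have hac : a ≠ c := by rintro rfl; exact h1 h2.symm
  rcases h a b c hab hac hbc with h | h | h
  · exact absurd (h x hxa hxb hxc) h1
  · exact absurd ((h x hxa hxb hxc).trans h2.symm) h1
  · exact h y hya hyb hyc

/-- By hypothesis each vertex of the class sees all or none of the other members, so a single edge
spreads to the whole class. -/
theorem clique_or_independent (p : V → Prop)
    (h : ∀ x b c, p x → p b → p c → b ≠ x → c ≠ x → (G.Adj x b ↔ G.Adj x c)) :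
    (∀ x y, p x → p y → x ≠ y → G.Adj x y) ∨ (∀ x y, p x → p y → ¬ G.Adj x y) := by
  by_cases hex : ∃ b c, p b ∧ p c ∧ G.Adj b c
  · obtain ⟨b, c, hb, hc, hbc⟩ := hex
    left
    intro d e hd he hde
    by_cases hdb : d = b
    · subst hdb
      exact (h d c e hd hc he hbc.ne.symm hde.symm).1 hbc
    · have h1 : G.Adj b d := (h b c d hb hc hd hbc.ne.symm hdb).1 hbc
      exact (h d b e hd hb he (Ne.symm hdb) hde.symm).1 h1.symm
  · right
    intro x y hx hy hxy
    exact hex ⟨x, y, hx, hy, hxy⟩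

/-- The vertex `w` separates its neighbours from its non-neighbours. Adding to two vertices of one
kind a third of the other kind shows, by `not_separated`, that no further vertex separates the two.
If no vertex has two non-neighbours besides itself, the complement of `G` is a matching and is
treated directly. -/
theorem HasTwinsInTriples.exists_decomposition (hT : HasTwinsInTriples G)
    (hN : HasCommonNeighbors G) (hG : G ≠ ⊤) :
    ∃ w, (∃ a, G.Adj w a) ∧ (∃ b, b ≠ w ∧ ¬ G.Adj w b) ∧
      (∀ a b, G.Adj w a → ¬ G.Adj w b → G.Adj a b) ∧
      (((∀ x y, G.Adj w x → G.Adj w y → ¬ G.Adj x y) ∧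
          (∀ x y, ¬ G.Adj w x → ¬ G.Adj w y → ¬ G.Adj x y)) ∨
        ((∀ x y, G.Adj w x → G.Adj w y → x ≠ y → G.Adj x y) ∧
          (∀ x y, ¬ G.Adj w x → ¬ G.Adj w y → ¬ G.Adj x y)) ∨
        ((∀ x y, G.Adj w x → G.Adj w y → x ≠ y → G.Adj x y) ∧
          (∀ x y, x ≠ w → y ≠ w → ¬ G.Adj w x → ¬ G.Adj w y → x ≠ y → G.Adj x y))) := by
  by_cases hcase : ∃ w b₁ b₂, b₁ ≠ b₂ ∧ b₁ ≠ w ∧ b₂ ≠ w ∧ ¬ G.Adj w b₁ ∧ ¬ G.Adj w b₂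
  · obtain ⟨w, b₁, b₂, hb, hb₁, hb₂, hn₁, hn₂⟩ := hcase
    have hB : ∀ x, x ≠ w → ∀ b c, b ≠ w → c ≠ w → ¬ G.Adj w b → ¬ G.Adj w c → b ≠ x → c ≠ x →
        (G.Adj x b ↔ G.Adj x c) := by
      intro x hx b c hbw hcw hnb hnc hbx hcx
      by_cases hbc : b = c
      · rw [hbc]
      by_cases ha : ∃ a, G.Adj w a ∧ a ≠ x
      · obtain ⟨a, ha, hax⟩ := ha
        exact hT.not_separated (x := w) hbc ha.ne hbw.symm hcw.symm hax.symm hbx.symm hcx.symm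
          (by tauto) (by tauto)
      -- Here `x` is the only possible neighbour of `w`, so it is the common neighbour of `w` with
      -- both `b` and `c`.
      · push Not at ha
        obtain ⟨y, hy, hyb⟩ := hN w b hbw.symm hnb
        obtain ⟨z, hz, hzc⟩ := hN w c hcw.symm hnc
        rw [ha y hy] at hyb
        rw [ha z hz] at hzc
        tauto
    have hA : ∀ x, x ≠ w → ∀ a c, G.Adj w a → G.Adj w c → a ≠ x → c ≠ x →
        (G.Adj x a ↔ G.Adj x c) := by
      intro x hx a c ha hc hax hcx
      by_cases hac : a = c
      · rw [hac]
      -- Two non-neighbours are needed because one of them may be `x`.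
      obtain ⟨b, hbw, hbn, hbx⟩ : ∃ b, b ≠ w ∧ ¬ G.Adj w b ∧ b ≠ x := by
        by_cases h : b₁ = x
        · exact ⟨b₂, hb₂, hn₂, fun h' => hb (h.trans h'.symm)⟩
        · exact ⟨b₁, hb₁, hn₁, h⟩
      exact hT.not_separated (x := w) hac hbw.symm ha.ne hc.ne hbx.symm hax.symm hcx.symm
        (by tauto) (by tauto)
    have hAB : ∀ a b, G.Adj w a → b ≠ w → ¬ G.Adj w b → G.Adj a b := by
      intro a b ha hbw hbn
      obtain ⟨y, hy, hyb⟩ := hN w b hbw.symm hbn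
      refine ((hA b hbw y a hy ha hyb.ne ?_).1 hyb.symm).symm
      rintro rfl
      exact hbn ha
    obtain ⟨a₀, ha₀, -⟩ := hN w b₁ hb₁.symm hn₁
    refine ⟨w, ⟨a₀, ha₀⟩, ⟨b₁, hb₁, hn₁⟩, ?_, ?_⟩
    · intro a b ha hbn
      by_cases hbw : b = w
      · rw [hbw]
        exact ha.symm
      · exact hAB a b ha hbw hbn
    have hindep : (∀ x y, (x ≠ w ∧ ¬ G.Adj w x) → (y ≠ w ∧ ¬ G.Adj w y) → ¬ G.Adj x y) →
        ∀ x y, ¬ G.Adj w x → ¬ G.Adj w y → ¬ G.Adj x y := by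
      intro h x y hx hy hxy
      by_cases hxw : x = w
      · exact hy (hxw ▸ hxy)
      by_cases hyw : y = w
      · exact hx (hyw ▸ hxy.symm)
      exact h x y ⟨hxw, hx⟩ ⟨hyw, hy⟩ hxy
    rcases clique_or_independent (G := G) (fun b => b ≠ w ∧ ¬ G.Adj w b)
      (fun x b c hx hb hc => hB x hx.1 b c hb.1 hc.1 hb.2 hc.2) with hBc | hBi
    · right; right
      refine ⟨?_, fun x y hx hy hnx hny => hBc x y ⟨hx, hnx⟩ ⟨hy, hny⟩⟩
      rcases clique_or_independent (G := G) (fun a => G.Adj w a)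
        (fun x b c hx hb hc => hA x hx.ne.symm b c hb hc) with hAc | hAi
      · exact hAc
      -- An independent `A` beside a clique `B \ {w}` has only one vertex: `b₁` separates `w` from
      -- `a'` and `b₂`, so `a`, which sees `b₂`, must also see `a'`.
      · intro a a' ha ha' hne
        exfalso
        have h1 := hAB a b₁ ha hb₁ hn₁
        have h2 := hAB a' b₁ ha' hb₁ hn₁
        have h3 := hAB a b₂ ha hb₂ hn₂
        have h4 := hAB a' b₂ ha' hb₂ hn₂
        have h5 := hBc b₁ b₂ ⟨hb₁, hn₁⟩ ⟨hb₂, hn₂⟩ hb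
        have h6 := hT.not_separated (x := b₁) (y := a) (a := w) (b := a') (c := b₂) h4.ne hb₁
          h2.ne.symm hb ha.ne.symm hne h3.ne
          (fun h => hn₁ (h.2 h2.symm).symm) (iff_of_true h2.symm h5)
        exact hAi a a' ha ha' (h6.2 h3)
    · rcases clique_or_independent (G := G) (fun a => G.Adj w a)
        (fun x b c hx hb hc => hA x hx.ne.symm b c hb hc) with hAc | hAi
      · exact Or.inr (Or.inl ⟨hAc, hindep hBi⟩)
      · exact Or.inl ⟨hAi, hindep hBi⟩
  · have huniq : ∀ w b b', b ≠ w → b' ≠ w → ¬ G.Adj w b → ¬ G.Adj w b' → b = b' := by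
      intro w b b' hb hb' hn hn'
      by_contra hne
      exact hcase ⟨w, b, b', hne, hb, hb', hn, hn'⟩
    obtain ⟨w, b, hwb, hna⟩ : ∃ x y, x ≠ y ∧ ¬ G.Adj x y := by
      by_contra! h
      exact hG (top_le_iff.1 fun a b hab => h a b (by simpa using hab))
    obtain ⟨a₀, ha₀, -⟩ := hN w b hwb hna
    have hAB : ∀ a, G.Adj w a → G.Adj a b := by
      intro a ha
      by_contra hab
      have hne : a ≠ b := by
        rintro rfl
        exact hna ha
      exact ha.ne (huniq b w a hwb hne (fun h => hna h.symm) (fun h => hab h.symm))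
    have hBw : ∀ x, ¬ G.Adj w x → x = w ∨ x = b := by
      intro x hx
      by_cases hxw : x = w
      · exact Or.inl hxw
      · exact Or.inr (huniq w x b hxw hwb.symm hx hna)
    have hBi : ∀ x y, ¬ G.Adj w x → ¬ G.Adj w y → ¬ G.Adj x y := by
      intro x y hx hy
      rcases hBw x hx with rfl | rfl
      · exact hy
      · rcases hBw y hy with rfl | rfl
        · exact fun h => hx h.symm
        · exact G.loopless.irrefl _
    refine ⟨w, ⟨a₀, ha₀⟩, ⟨b, hwb.symm, hna⟩, ?_, ?_⟩
    · intro a x ha hx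
      rcases hBw x hx with rfl | rfl
      · exact ha.symm
      · exact hAB a ha
    by_cases hAc : ∀ x y, G.Adj w x → G.Adj w y → x ≠ y → G.Adj x y
    · exact Or.inr (Or.inl ⟨hAc, hBi⟩)
    · push Not at hAc
      obtain ⟨a, a', ha, ha', hne, haa⟩ := hAc
      -- A third neighbour `z` of `w` would be adjacent to `a`; as `w` separates `b` from `a'` and
      -- `z`, also `a` would be adjacent to `a'`. Hence `A` consists of two nonadjacent vertices and
      -- `G` is a 4-cycle.
      have hall : ∀ z, G.Adj w z → z = a ∨ z = a' := by
        intro z hz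
        by_contra! hza
        have haz : G.Adj a z := by
          by_contra haz
          exact hza.2 (huniq a z a' hza.1 hne.symm haz haa)
        have h6 := hT.not_separated (x := w) (y := a) (a := b) (b := a') (c := z) hza.2.symm hwb
          ha'.ne hz.ne (hAB a ha).ne hne hza.1.symm (fun h => hna (h.2 ha'))
          (iff_of_true ha' hz)
        exact haa (h6.2 haz)
      refine Or.inl ⟨?_, hBi⟩
      intro x y hx hy
      rcases hall x hx with rfl | rfl <;> rcases hall y hy with rfl | rfl
      · exact G.loopless.irrefl _
      · exact haa
      · exact fun h => haa h.symm
      · exact G.loopless.irrefl _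

end Structure

/-! ### The three families, as joins, have the structural properties and are the only such graphs.
-/

section Families

variable {V W U : Type*} {G : SimpleGraph V} {H : SimpleGraph W} {I : SimpleGraph U}

theorem nonempty_iso_joinGraph (p : V → Prop) (e₁ : G.induce {x | p x} ≃g H)
    (e₂ : G.induce {x | ¬ p x} ≃g I) (h : ∀ x y, p x → ¬ p y → G.Adj x y) :
    Nonempty (G ≃g joinGraph H I) := by
  classical
  refine ⟨Iso.symm ⟨(Equiv.sumCongr e₁.symm.toEquiv e₂.symm.toEquiv).trans
    (Equiv.sumCompl p), ?_⟩⟩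
  rintro (a | a) (b | b)
  · exact (e₁.symm.map_adj_iff (v := a) (w := b)).trans (by simp [joinGraph])
  · exact iff_of_true (h _ _ (e₁.symm a).2 (e₂.symm b).2) (by simp [joinGraph])
  · exact iff_of_true (h _ _ (e₁.symm b).2 (e₂.symm a).2).symm (by simp [joinGraph])
  · exact (e₂.symm.map_adj_iff (v := a) (w := b)).trans (by simp [joinGraph])

theorem nonempty_iso_sum (p : V → Prop) (e₁ : G.induce {x | p x} ≃g H)
    (e₂ : G.induce {x | ¬ p x} ≃g I) (h : ∀ x y, p x → ¬ p y → ¬ G.Adj x y) :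
    Nonempty (G ≃g SimpleGraph.sum H I) := by
  classical
  refine ⟨Iso.symm ⟨(Equiv.sumCongr e₁.symm.toEquiv e₂.symm.toEquiv).trans
    (Equiv.sumCompl p), ?_⟩⟩
  rintro (a | a) (b | b)
  · exact (e₁.symm.map_adj_iff (v := a) (w := b)).trans (by simp)
  · exact iff_of_false (h _ _ (e₁.symm a).2 (e₂.symm b).2) (by simp)
  · exact iff_of_false (fun hadj => h _ _ (e₁.symm b).2 (e₂.symm a).2 hadj.symm) (by simp)
  · exact (e₂.symm.map_adj_iff (v := a) (w := b)).trans (by simp)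

theorem completeBipartiteGraph_eq_joinGraph :
    completeBipartiteGraph V W = joinGraph (⊥ : SimpleGraph V) (⊥ : SimpleGraph W) := by
  ext (a | a) (b | b) <;> simp [joinGraph]

theorem compl_K (n : ℕ) : (K n)ᶜ = ⊥ := by
  rw [K, completeGraph_eq_top, compl_top]

theorem nonempty_iso_bot [Fintype V] (h : ∀ x y, ¬ G.Adj x y) :
    Nonempty (G ≃g (⊥ : SimpleGraph (Fin (Fintype.card V)))) :=
  ⟨⟨Fintype.equivFin V, by simp [h]⟩⟩

theorem nonempty_iso_K [Fintype V] (h : ∀ x y, x ≠ y → G.Adj x y) :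
    Nonempty (G ≃g K (Fintype.card V)) :=
  nonempty_iso_K_iff.2 (top_le_iff.1 fun x y hxy => h x y (by simpa using hxy))

theorem inFamily_of_hasTwinsInTriples [Fintype V] (hT : HasTwinsInTriples G)
    (hN : HasCommonNeighbors G) (hG : G ≠ ⊤) : InFamily G := by
  classical
  obtain ⟨w, ⟨a, ha⟩, ⟨b, hbw, hb⟩, hAB, h⟩ := hT.exists_decomposition hN hG
  have hA : 1 ≤ Fintype.card {x | G.Adj w x} := Fintype.card_pos_iff.2 ⟨⟨a, ha⟩⟩
  have hB : 2 ≤ Fintype.card {x | ¬ G.Adj w x} :=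
    Fintype.one_lt_card_iff.2 ⟨⟨b, hb⟩, ⟨w, G.loopless.irrefl w⟩, by simpa using hbw⟩
  rcases h with ⟨h1, h2⟩ | ⟨h1, h2⟩ | ⟨h1, h2⟩
  · left
    obtain ⟨e₁⟩ := nonempty_iso_bot (G := G.induce {x | G.Adj w x}) fun x y => h1 x y x.2 y.2
    obtain ⟨e₂⟩ := nonempty_iso_bot (G := G.induce {x | ¬ G.Adj w x}) fun x y => h2 x y x.2 y.2
    refine ⟨_, _, hA, one_le_two.trans hB, ?_⟩
    rw [completeBipartiteGraph_eq_joinGraph]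
    exact nonempty_iso_joinGraph _ e₁ e₂ hAB
  · right; left
    obtain ⟨e₁⟩ := nonempty_iso_K (G := G.induce {x | G.Adj w x})
      fun x y hxy => h1 x y x.2 y.2 (Subtype.coe_injective.ne hxy)
    obtain ⟨e₂⟩ := nonempty_iso_bot (G := G.induce {x | ¬ G.Adj w x}) fun x y => h2 x y x.2 y.2
    refine ⟨_, _, hA, hB, ?_⟩
    rw [compl_K]
    exact nonempty_iso_joinGraph _ e₁ e₂ hAB
  · right; right
    obtain ⟨e₁⟩ := nonempty_iso_K (G := G.induce {x | G.Adj w x})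
      fun x y hxy => h1 x y x.2 y.2 (Subtype.coe_injective.ne hxy)
    -- On the non-neighbour side `w` is isolated and supplies the summand `K 1`; the remaining
    -- clique supplies `K t`.
    set G' := G.induce {x | ¬ G.Adj w x} with hG'
    let w' : {x | ¬ G.Adj w x} := ⟨w, G.loopless.irrefl w⟩
    have : Unique {x : {x | ¬ G.Adj w x} | x = w'} := ⟨⟨⟨w', rfl⟩⟩, fun x => Subtype.ext x.2⟩
    obtain ⟨f₁⟩ := nonempty_iso_K (G := G'.induce {x | x = w'})
      fun x y hxy => absurd (Subsingleton.elim x y) hxy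
    obtain ⟨f₂⟩ := nonempty_iso_K (G := G'.induce {x | ¬ x = w'}) fun x y hxy =>
      h2 x.1.1 y.1.1 (fun h => x.2 (Subtype.ext h)) (fun h => y.2 (Subtype.ext h)) x.1.2 y.1.2
        (fun h => hxy (Subtype.ext (Subtype.ext h)))
    obtain ⟨e₂⟩ := nonempty_iso_sum _ f₁ f₂ (by
      rintro x y rfl -
      exact y.2)
    rw [Fintype.card_unique] at e₂
    refine ⟨_, _, hA, ?_, nonempty_iso_joinGraph _ e₁ e₂ hAB⟩
    exact Fintype.card_pos_iff.2 ⟨⟨⟨b, hb⟩, fun h => hbw (congrArg Subtype.val h)⟩⟩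

theorem hasTwinsInTriples_completeBipartiteGraph :
    HasTwinsInTriples (completeBipartiteGraph V W) := by
  rintro (a | a) (b | b) (c | c) hab hac hbc <;> simp

theorem hasTwinsInTriples_joinGraph_top_bot :
    HasTwinsInTriples (joinGraph (⊤ : SimpleGraph V) (⊥ : SimpleGraph W)) := by
  rintro (a | a) (b | b) (c | c) hab hac hbc <;> simp +contextual [joinGraph]

/-- Vertices of `V` are twins of one another, and so are those of `U`. A vertex of `V` and one of
`U` disagree only at the single vertex of `W`, which belongs to the triple whenever the triple meets
all three classes. -/
theorem hasTwinsInTriples_joinGraph_top_sum [Subsingleton W] :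
    HasTwinsInTriples (joinGraph (⊤ : SimpleGraph V)
      (SimpleGraph.sum (⊤ : SimpleGraph W) (⊤ : SimpleGraph U))) := by
  set J := joinGraph (⊤ : SimpleGraph V) (SimpleGraph.sum (⊤ : SimpleGraph W) (⊤ : SimpleGraph U))
    with hJ
  have hVV : ∀ (x y : V) (w : V ⊕ (W ⊕ U)), w ≠ Sum.inl x → w ≠ Sum.inl y →
      (J.Adj w (Sum.inl x) ↔ J.Adj w (Sum.inl y)) := by
    rintro x y (w | w | w) <;> simp +contextual [hJ, joinGraph]
  have hUU : ∀ (x y : U) (w : V ⊕ (W ⊕ U)), w ≠ Sum.inr (Sum.inr x) → w ≠ Sum.inr (Sum.inr y) →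
      (J.Adj w (Sum.inr (Sum.inr x)) ↔ J.Adj w (Sum.inr (Sum.inr y))) := by
    rintro x y (w | w | w) <;> simp +contextual [hJ, joinGraph]
  have hVU : ∀ (x : V) (y : U) (z : W) (w : V ⊕ (W ⊕ U)), w ≠ Sum.inl x →
      w ≠ Sum.inr (Sum.inr y) → w ≠ Sum.inr (Sum.inl z) →
      (J.Adj w (Sum.inl x) ↔ J.Adj w (Sum.inr (Sum.inr y))) := by
    rintro x y z (w | w | w) <;> simp +contextual [hJ, joinGraph, Subsingleton.elim _ z]
  have hW : ∀ x y : W, x = y := Subsingleton.elim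
  rintro (a | a | a) (b | b | b) (c | c | c) hab hac hbc <;>
    first
    | exact absurd (by rw [hW a b]) hab
    | exact absurd (by rw [hW a c]) hac
    | exact absurd (by rw [hW b c]) hbc
    | exact Or.inl fun w ha hb _ => hVV _ _ w ha hb
    | exact Or.inr (Or.inl fun w ha _ hc => hVV _ _ w ha hc)
    | exact Or.inr (Or.inr fun w _ hb hc => hVV _ _ w hb hc)
    | exact Or.inl fun w ha hb _ => hUU _ _ w ha hb
    | exact Or.inr (Or.inl fun w ha _ hc => hUU _ _ w ha hc)
    | exact Or.inr (Or.inr fun w _ hb hc => hUU _ _ w hb hc)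
    | exact Or.inl fun w ha hb hc => hVU _ _ _ w ha hb hc
    | exact Or.inl fun w ha hb hc => (hVU _ _ _ w hb ha hc).symm
    | exact Or.inr (Or.inl fun w ha hb hc => hVU _ _ _ w ha hc hb)
    | exact Or.inr (Or.inl fun w ha hb hc => (hVU _ _ _ w hc ha hb).symm)
    | exact Or.inr (Or.inr fun w ha hb hc => hVU _ _ _ w hb hc ha)
    | exact Or.inr (Or.inr fun w ha hb hc => (hVU _ _ _ w hc hb ha).symm)

theorem hasCommonNeighbors_completeBipartiteGraph [Nonempty V] [Nonempty W] :
    HasCommonNeighbors (completeBipartiteGraph V W) := by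
  rintro (a | a) (b | b) hab hna
  · exact ⟨Sum.inr (Classical.arbitrary W), by simp⟩
  · simp at hna
  · simp at hna
  · exact ⟨Sum.inl (Classical.arbitrary V), by simp⟩

theorem hasCommonNeighbors_joinGraph_top [Nonempty V] (H : SimpleGraph W) :
    HasCommonNeighbors (joinGraph (⊤ : SimpleGraph V) H) := by
  rintro (a | a) (b | b) hab hna
  · exact absurd (by simpa using hab) (by simpa [joinGraph] using hna)
  · simp [joinGraph] at hna
  · simp [joinGraph] at hna
  · exact ⟨Sum.inl (Classical.arbitrary V), by simp [joinGraph]⟩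

theorem ne_top_of_not_adj {u v : V} (huv : u ≠ v) (h : ¬ G.Adj u v) : G ≠ ⊤ := by
  rintro rfl
  exact h huv

theorem properties_of_inFamily [Fintype V] (hn : 4 ≤ Fintype.card V) (h : InFamily G) :
    HasTwinsInTriples G ∧ HasCommonNeighbors G ∧ G ≠ ⊤ := by
  rcases h with ⟨s, t, hs, ht, ⟨e⟩⟩ | ⟨s, t, hs, ht, ⟨e⟩⟩ | ⟨s, t, hs, ht, ⟨e⟩⟩
  · have : NeZero s := ⟨by omega⟩
    have : NeZero t := ⟨by omega⟩
    refine ⟨hasTwinsInTriples_completeBipartiteGraph.of_iso e,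
      hasCommonNeighbors_completeBipartiteGraph.of_iso e, ne_top_of_iso ?_ e⟩
    have hcard := Fintype.card_congr e.toEquiv
    rw [Fintype.card_sum, Fintype.card_fin, Fintype.card_fin] at hcard
    -- `K_{1,1}` is complete; the order being at least 4 ensures that some part has two vertices.
    by_cases hs2 : 2 ≤ s
    · exact ne_top_of_not_adj (u := Sum.inl ⟨0, hs⟩) (v := Sum.inl ⟨1, hs2⟩) (by simp) (by simp)
    · exact ne_top_of_not_adj (u := Sum.inr ⟨0, ht⟩) (v := Sum.inr ⟨1, by omega⟩) (by simp)
        (by simp)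
  · have : NeZero s := ⟨by omega⟩
    rw [compl_K, K, completeGraph_eq_top] at e
    refine ⟨hasTwinsInTriples_joinGraph_top_bot.of_iso e,
      (hasCommonNeighbors_joinGraph_top _).of_iso e, ne_top_of_iso ?_ e⟩
    exact ne_top_of_not_adj (u := Sum.inr ⟨0, by omega⟩) (v := Sum.inr ⟨1, ht⟩) (by simp)
      (by simp [joinGraph])
  · have : NeZero s := ⟨by omega⟩
    simp only [K, completeGraph_eq_top] at e
    refine ⟨hasTwinsInTriples_joinGraph_top_sum.of_iso e,
      (hasCommonNeighbors_joinGraph_top _).of_iso e, ne_top_of_iso ?_ e⟩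
    exact ne_top_of_not_adj (u := Sum.inr (Sum.inl 0)) (v := Sum.inr (Sum.inr ⟨0, ht⟩))
      (by simp) (by simp [joinGraph])

end Families

/-! ### Value `n - 2`. -/

section OrderMinusTwo

variable {V : Type*} {G : SimpleGraph V} {k : ℕ}

theorem HasCommonNeighbors.edist_le_two (hN : HasCommonNeighbors G) (u v : V) :
    G.edist u v ≤ 2 := by
  by_cases huv : u = v
  · subst huv
    simp
  by_cases hadj : G.Adj u v
  · rw [edist_eq_one_iff_adj.2 hadj]
    decide
  · obtain ⟨x, hux, hxv⟩ := hN u v huv hadj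
    exact (edist_eq_two_iff.2 ⟨huv, hadj, x, hux, hxv.symm⟩).le

/-- Every vertex other than `w` is at distance 1 or 2 from it, so adjacency determines the distance.
-/
theorem HasCommonNeighbors.edist_eq_edist_iff (hN : HasCommonNeighbors G) {u v w : V}
    (hu : u ≠ w) (hv : v ≠ w) : G.edist u w = G.edist v w ↔ (G.Adj w u ↔ G.Adj w v) := by
  have h2 : ∀ x, x ≠ w → ¬ G.Adj w x → G.edist x w = 2 := by
    intro x hx hadj
    have hadj' : ¬ G.Adj x w := fun h => hadj h.symm
    obtain ⟨y, hxy, hyw⟩ := hN x w hx hadj'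
    exact edist_eq_two_iff.2 ⟨hx, hadj', y, hxy, hyw.symm⟩
  have h1 : ∀ x, G.Adj w x → G.edist x w = 1 := fun x h => edist_eq_one_iff_adj.2 h.symm
  by_cases hwu : G.Adj w u <;> by_cases hwv : G.Adj w v
  · simp [h1, hwu, hwv]
  · simp [h1, h2, hwu, hwv, hv]
  · simp [h1, h2, hwu, hwv, hu]
  · simp [h2, hwu, hwv, hu, hv]

/-- A connected graph with nonadjacent vertices lacking a common neighbour has a geodesic of
length three. -/
theorem exists_geodesic_three (hc : G.Connected) (hN : ¬ HasCommonNeighbors G) :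
    ∃ x₀ x₁ x₂ x₃, G.Adj x₀ x₁ ∧ G.Adj x₁ x₂ ∧ G.Adj x₂ x₃ ∧ G.dist x₀ x₃ = 3 ∧
      G.dist x₀ x₂ = 2 ∧ G.dist x₁ x₃ = 2 := by
  unfold HasCommonNeighbors at hN
  push Not at hN
  obtain ⟨u, v, huv, hna, hcn⟩ := hN
  have hd : 3 ≤ G.dist u v := by
    have h2 := hc.one_lt_dist_of_ne_of_not_adj huv hna
    by_contra hlt
    obtain ⟨x, hxv, hux⟩ := exists_adj_dist_eq hc (show G.dist u v = 1 + 1 by omega)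
    exact hcn x (dist_eq_one_iff_adj.1 hux) hxv
  obtain ⟨x₃, h3⟩ := exists_dist_eq_of_le hc hd
  obtain ⟨x₂, h23, h2⟩ := exists_adj_dist_eq hc h3
  obtain ⟨x₁, h12, h1⟩ := exists_adj_dist_eq hc h2
  refine ⟨u, x₁, x₂, x₃, dist_eq_one_iff_adj.1 h1, h12, h23, h3, h2, ?_⟩
  have t1 := hc.dist_triangle (u := u) (v := x₁) (w := x₃)
  have t2 := hc.dist_triangle (u := x₁) (v := x₂) (w := x₃)
  rw [dist_eq_one_iff_adj.2 h12, dist_eq_one_iff_adj.2 h23] at t2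
  omega

/-- A connected graph is covered by any nonempty set of vertices closed under adjacency. -/
theorem mem_of_connected (hc : G.Connected) {T : Set V} {u : V} (hu : u ∈ T)
    (hT : ∀ x y, x ∈ T → G.Adj x y → y ∈ T) (v : V) : v ∈ T := by
  obtain ⟨p⟩ := hc u v
  induction p with
  | nil => exact hu
  | cons h p ih => exact ih (hT _ _ hu h)

variable [Fintype V]

/-- Three vertices outside a resolving set would include a pair that the set cannot separate. -/
theorem HasTwinsInTriples.card_sub_two_le (hT : HasTwinsInTriples G)
    (hN : HasCommonNeighbors G) :
    Fintype.card V - 2 ≤ distResolvingDominationNumber G k := by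
  classical
  obtain ⟨S, hS, hcard⟩ := exists_card_eq_distResolvingDominationNumber G k
  rw [← hcard]
  by_contra! hlt
  have h3 : 2 < Sᶜ.card := by
    rw [Finset.card_compl]
    omega
  obtain ⟨a, ha, b, hb, c, hc, hab, hac, hbc⟩ := Finset.two_lt_card.1 h3
  rw [Finset.mem_compl] at ha hb hc
  have hS' : ∀ {w x}, w ∈ S → x ∉ S → w ≠ x := by
    rintro w x hw hx rfl
    exact hx hw
  have key : ∀ u v, u ∉ S → v ∉ S → u ≠ v →
      ¬ ∀ w, w ≠ a → w ≠ b → w ≠ c → (G.Adj w u ↔ G.Adj w v) := by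
    intro u v hu hv huv h
    obtain ⟨w, hw, hd⟩ := isResolvingSet_iff.1 hS.1 u v hu hv huv
    exact hd ((hN.edist_eq_edist_iff (hS' hw hu).symm (hS' hw hv).symm).2
      (h w (hS' hw ha) (hS' hw hb) (hS' hw hc)))
  rcases hT a b c hab hac hbc with h | h | h
  · exact key a b ha hb hab h
  · exact key a c ha hc hac h
  · exact key b c hb hc hbc h

theorem HasCommonNeighbors.hasTwinsInTriples (hN : HasCommonNeighbors G)
    (hn : 4 ≤ Fintype.card V) (hk : 2 ≤ k)
    (h : Fintype.card V - 2 ≤ distResolvingDominationNumber G k) : HasTwinsInTriples G := by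
  classical
  intro a b c hab hac hbc
  by_contra hT
  simp only [not_or, not_forall, exists_prop] at hT
  obtain ⟨h1, h2, h3⟩ := hT
  have hcard : ({a, b, c} : Finset V)ᶜ.card = Fintype.card V - 3 := by
    rw [Finset.card_compl, Finset.card_eq_three.2 ⟨a, b, c, hab, hac, hbc, rfl⟩]
  suffices hS : IsDistResolvingDominatingSet G k ({a, b, c} : Finset V)ᶜ by
    have := distResolvingDominationNumber_le hS
    omega
  have sep : ∀ u v, (∃ w, w ≠ a ∧ w ≠ b ∧ w ≠ c ∧ ¬ (G.Adj w u ↔ G.Adj w v)) →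
      (u = a ∨ u = b ∨ u = c) → (v = a ∨ v = b ∨ v = c) →
      ∃ w ∈ ({a, b, c} : Finset V)ᶜ, G.edist u w ≠ G.edist v w := by
    rintro u v ⟨w, hwa, hwb, hwc, hw⟩ hu hv
    refine ⟨w, by simp [hwa, hwb, hwc], ?_⟩
    rwa [Ne, hN.edist_eq_edist_iff]
    · rcases hu with rfl | rfl | rfl <;> exact Ne.symm ‹_›
    · rcases hv with rfl | rfl | rfl <;> exact Ne.symm ‹_›
  have swap : ∀ {u v}, (∃ w, w ≠ a ∧ w ≠ b ∧ w ≠ c ∧ ¬ (G.Adj w u ↔ G.Adj w v)) →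
      ∃ w, w ≠ a ∧ w ≠ b ∧ w ≠ c ∧ ¬ (G.Adj w v ↔ G.Adj w u) :=
    fun ⟨w, ha, hb, hc, h⟩ => ⟨w, ha, hb, hc, fun h' => h h'.symm⟩
  constructor
  · rw [isResolvingSet_iff]
    intro u v hu hv huv
    simp only [Finset.mem_compl, Finset.mem_insert, Finset.mem_singleton, not_not] at hu hv
    apply sep u v ?_ hu hv
    rcases hu with rfl | rfl | rfl <;> rcases hv with rfl | rfl | rfl <;>
      first
      | exact absurd rfl huv
      | assumption
      | exact swap h1
      | exact swap h2
      | exact swap h3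
  · intro v hv
    -- With at least four vertices something remains after omitting the triple, and it dominates
    -- since all distances are at most 2.
    obtain ⟨x, hx⟩ := Finset.card_pos.1 (by omega : 0 < ({a, b, c} : Finset V)ᶜ.card)
    exact ⟨x, hx, (hN.edist_le_two v x).trans (by exact_mod_cast hk)⟩

/-- Omitting the last three vertices of a geodesic of length three. -/
theorem distResolvingDominationNumber_add_three_le (hc : G.Connected) {x₀ x₁ x₂ x₃ : V}
    (h1 : G.dist x₀ x₁ = 1) (h2 : G.dist x₀ x₂ = 2) (h3 : G.dist x₀ x₃ = 3) (hk : 2 ≤ k)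
    (hdom : 3 ≤ k ∨ ∃ y, y ≠ x₁ ∧ y ≠ x₂ ∧ y ≠ x₃ ∧ G.dist x₃ y ≤ 2) :
    distResolvingDominationNumber G k + 3 ≤ Fintype.card V := by
  classical
  have hne : ∀ {u v}, G.dist x₀ u ≠ G.dist x₀ v → u ≠ v := by
    rintro u _ h rfl
    exact h rfl
  have h12 : x₁ ≠ x₂ := hne (by omega)
  have h13 : x₁ ≠ x₃ := hne (by omega)
  have h23 : x₂ ≠ x₃ := hne (by omega)
  have hx₀ : x₀ ∈ ({x₁, x₂, x₃} : Finset V)ᶜ := by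
    have h01 : x₀ ≠ x₁ := hne (by rw [dist_self]; omega)
    have h02 : x₀ ≠ x₂ := hne (by rw [dist_self]; omega)
    have h03 : x₀ ≠ x₃ := hne (by rw [dist_self]; omega)
    simp [h01, h02, h03]
  have hcard := Finset.card_compl_add_card ({x₁, x₂, x₃} : Finset V)
  rw [Finset.card_eq_three.2 ⟨x₁, x₂, x₃, h12, h13, h23, rfl⟩] at hcard
  rw [← hcard]
  refine Nat.add_le_add_right (distResolvingDominationNumber_le ⟨?_, ?_⟩) 3
  · rw [isResolvingSet_iff]
    intro u v hu hv huv
    refine ⟨x₀, hx₀, ?_⟩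
    rw [← (hc u x₀).coe_dist_eq_edist, ← (hc v x₀).coe_dist_eq_edist, Ne, Nat.cast_inj,
      dist_comm, dist_comm (u := v)]
    simp only [Finset.mem_compl, Finset.mem_insert, Finset.mem_singleton, not_not] at hu hv
    rcases hu with rfl | rfl | rfl <;> rcases hv with rfl | rfl | rfl <;>
      first | exact absurd rfl huv | omega
  · have key : ∀ v, (∃ x ∈ ({x₁, x₂, x₃} : Finset V)ᶜ, G.dist v x ≤ k) →
        ∃ x ∈ ({x₁, x₂, x₃} : Finset V)ᶜ, G.edist v x ≤ (k : ℕ∞) := by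
      rintro v ⟨x, hx, hd⟩
      refine ⟨x, hx, ?_⟩
      rw [← (hc v x).coe_dist_eq_edist]
      exact_mod_cast hd
    intro v hv
    apply key
    simp only [Finset.mem_compl, Finset.mem_insert, Finset.mem_singleton, not_not] at hv
    rcases hv with rfl | rfl | rfl
    · exact ⟨x₀, hx₀, by rw [dist_comm]; omega⟩
    · exact ⟨x₀, hx₀, by rw [dist_comm]; omega⟩
    · rcases hdom with hk3 | ⟨y, hy1, hy2, hy3, hy⟩
      · exact ⟨x₀, hx₀, by rw [dist_comm]; omega⟩
      · exact ⟨y, by simp [hy1, hy2, hy3], hy.trans hk⟩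

theorem nonempty_iso_pathGraph_four (hc : G.Connected) (hN : ¬ HasCommonNeighbors G)
    (hk : 2 ≤ k) (h : Fintype.card V - 2 ≤ distResolvingDominationNumber G k)
    (hn : 4 ≤ Fintype.card V) : k = 2 ∧ Nonempty (G ≃g pathGraph 4) := by
  classical
  obtain ⟨x₀, x₁, x₂, x₃, a01, a12, a23, d03, d02, d13⟩ := exists_geodesic_three hc hN
  have d01 : G.dist x₀ x₁ = 1 := dist_eq_one_iff_adj.2 a01
  have d12 : G.dist x₁ x₂ = 1 := dist_eq_one_iff_adj.2 a12
  have d23 : G.dist x₂ x₃ = 1 := dist_eq_one_iff_adj.2 a23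
  have d32 : G.dist x₃ x₂ = 1 := by rwa [dist_comm]
  have d31 : G.dist x₃ x₁ = 2 := by rwa [dist_comm]
  have d30 : G.dist x₃ x₀ = 3 := by rwa [dist_comm]
  have d10 : G.dist x₁ x₀ = 1 := by rwa [dist_comm]
  have hL : ¬ (3 ≤ k ∨ ∃ y, y ≠ x₁ ∧ y ≠ x₂ ∧ y ≠ x₃ ∧ G.dist x₃ y ≤ 2) := fun hdom => by
    have := distResolvingDominationNumber_add_three_le hc d01 d02 d03 hk hdom
    omega
  -- The same bound applied to the reversed geodesic.
  have hR : ¬ (3 ≤ k ∨ ∃ y, y ≠ x₂ ∧ y ≠ x₁ ∧ y ≠ x₀ ∧ G.dist x₀ y ≤ 2) := fun hdom => by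
    have := distResolvingDominationNumber_add_three_le hc d32 d31 d30 hk hdom
    omega
  push Not at hL hR
  refine ⟨by omega, ?_⟩
  -- A neighbour off the geodesic would lie within distance 2 of `x₀` or `x₃`, contrary to `hR` or
  -- `hL`.
  have hclosed : ∀ x y, x ∈ ({x₀, x₁, x₂, x₃} : Set V) → G.Adj x y →
      y ∈ ({x₀, x₁, x₂, x₃} : Set V) := by
    intro x y hx hxy
    have hd := dist_eq_one_iff_adj.2 hxy
    simp only [Set.mem_insert_iff, Set.mem_singleton_iff] at hx ⊢
    by_contra! hy
    have hl := hL.2 y hy.2.1 hy.2.2.1 hy.2.2.2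
    have hr := hR.2 y hy.2.2.1 hy.2.1 hy.1
    rcases hx with rfl | rfl | rfl | rfl
    · omega
    · have := hc.dist_triangle (u := x₀) (v := x) (w := y)
      omega
    · have := hc.dist_triangle (u := x₃) (v := x) (w := y)
      omega
    · omega
  have hall : ∀ v, v = x₀ ∨ v = x₁ ∨ v = x₂ ∨ v = x₃ := fun v => by
    simpa using mem_of_connected hc (T := {x₀, x₁, x₂, x₃}) (u := x₀) (by simp) hclosed v
  have hcard : Fintype.card V = 4 := by
    refine le_antisymm ?_ hn
    have hsub : (Finset.univ : Finset V) ⊆ {x₀, x₁, x₂, x₃} := fun v _ => by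
      simpa using hall v
    exact (Finset.card_le_card hsub).trans Finset.card_le_four
  rw [← hcard]
  refine nonempty_iso_pathGraph_of_dist_injective hc x₀ fun u v huv => ?_
  have d00 : G.dist x₀ x₀ = 0 := dist_self
  rcases hall u with rfl | rfl | rfl | rfl <;> rcases hall v with rfl | rfl | rfl | rfl <;>
    first | rfl | omega

/-- The value is at most 2, and it is not 1 because for `k = 2` that allows at most three vertices.
-/
theorem distResolvingDominationNumber_of_iso_pathGraph_four (hc : G.Connected)
    (hn : 4 ≤ Fintype.card V) (e : G ≃g pathGraph 4) :
    distResolvingDominationNumber G 2 = Fintype.card V - 2 := by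
  have hV : Nonempty V := Fintype.card_pos_iff.1 (by omega)
  have hcard : Fintype.card V = 4 := by simpa using Fintype.card_congr e.toEquiv
  have hG : G ≠ ⊤ := by
    rintro rfl
    have h : (⊤ : SimpleGraph V).Adj (e.symm 0) (e.symm 2) :=
      e.symm.injective.ne (by decide)
    rw [e.symm.map_adj_iff, pathGraph_adj] at h
    revert h
    decide
  have hle := distResolvingDominationNumber_le_card_sub_two hc hG le_rfl
  have hpos : 0 < distResolvingDominationNumber G 2 := distResolvingDominationNumber_pos
  have hne : distResolvingDominationNumber G 2 ≠ 1 := by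
    rw [Ne, distResolvingDominationNumber_eq_one_iff (by omega)]
    rintro ⟨i, -, hi, ⟨f⟩⟩
    have : Fintype.card V = i := by simpa using Fintype.card_congr f.toEquiv
    omega
  omega

theorem distResolvingDominationNumber_of_inFamily (hc : G.Connected)
    (hn : 4 ≤ Fintype.card V) (hk : 2 ≤ k) (h : InFamily G) :
    distResolvingDominationNumber G k = Fintype.card V - 2 := by
  obtain ⟨hT, hN, hG⟩ := properties_of_inFamily hn h
  exact le_antisymm (distResolvingDominationNumber_le_card_sub_two hc hG hk)
    (hT.card_sub_two_le hN)

theorem inFamily_or_iso_pathGraph_four (hc : G.Connected) (hn : 4 ≤ Fintype.card V)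
    (hk : 2 ≤ k) (h : distResolvingDominationNumber G k = Fintype.card V - 2) :
    (k = 2 ∧ Nonempty (G ≃g pathGraph 4)) ∨ InFamily G := by
  by_cases hN : HasCommonNeighbors G
  · refine Or.inr (inFamily_of_hasTwinsInTriples (hN.hasTwinsInTriples hn hk h.ge) hN ?_)
    rintro rfl
    rw [distResolvingDominationNumber_top (by omega) (by omega)] at h
    omega
  · exact Or.inl (nonempty_iso_pathGraph_four hc hN hk h.ge hn)

end OrderMinusTwo

end ResolvingDomination

theorem mainTheorem1 {V : Type*} [Fintype V] (G : SimpleGraph V) (hn : 2 ≤ Fintype.card V) :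
    (∀ k : ℕ, 1 ≤ k →
      (ResolvingDomination.distResolvingDominationNumber G k = 1 ↔
        ∃ i : ℕ, 2 ≤ i ∧ i ≤ k + 1 ∧ Nonempty (G ≃g SimpleGraph.pathGraph i))) ∧
    (G.Connected → 4 ≤ Fintype.card V →
      (ResolvingDomination.distResolvingDominationNumber G 2 = Fintype.card V - 2 ↔
        Nonempty (G ≃g SimpleGraph.pathGraph 4) ∨ ResolvingDomination.InFamily G) ∧
      (∀ k : ℕ, 3 ≤ k →
        (ResolvingDomination.distResolvingDominationNumber G k = Fintype.card V - 2 ↔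
          ResolvingDomination.InFamily G))) ∧
    (G.Connected → ∀ k : ℕ, 2 ≤ k →
      (ResolvingDomination.distResolvingDominationNumber G k = Fintype.card V - 1 ↔
        Nonempty (G ≃g ResolvingDomination.K (Fintype.card V)))) := by
  refine ⟨fun k _ => ResolvingDomination.distResolvingDominationNumber_eq_one_iff hn k,
    fun hc hn4 => ⟨⟨fun h => ?_, ?_⟩, fun k hk => ⟨fun h => ?_, fun h => ?_⟩⟩,
    fun hc k hk => ResolvingDomination.distResolvingDominationNumber_eq_card_sub_one_iff hn hc hk⟩
  · exact (ResolvingDomination.inFamily_or_iso_pathGraph_four hc hn4 le_rfl h).imp_left And.right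
  · rintro (⟨⟨e⟩⟩ | h)
    · exact ResolvingDomination.distResolvingDominationNumber_of_iso_pathGraph_four hc hn4 e
    · exact ResolvingDomination.distResolvingDominationNumber_of_inFamily hc hn4 le_rfl h
  · rcases ResolvingDomination.inFamily_or_iso_pathGraph_four hc hn4 (by omega) h with h | h
    · omega
    · exact h
  · exact ResolvingDomination.distResolvingDominationNumber_of_inFamily hc hn4 (by omega) h
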